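/- Let $i\ge 2$, let $X_i$ be an alphabet with $i$ letters, and let $|u|_i$ be the length of $u\in X_i^*$. A *machine* over $X_j$ is a partial computable function $T$ from $X_j^*$ to $X_j^*$ with prefix-free domain, and $H_{j,T}(x)=\min\{|y|_j : T(y)=x\}$ (with $\min\emptyset=\infty$). Fix a machine $U_2$ over $X_2$ that is universal (for every machine $T$ over $X_2$ there is a constant $c$ with $H_{2,U_2}\le H_{2,T}+c$ on $X_2^*$), and put $H_2=H_{2,U_2}$. A *Gödel numbering* is a computable injective function $g:X_i^*\to X_2^*$. Fix a formal language over $X_i$ for first-order arithmetic (symbols $0,S,+,\cdot,=,\neg,\to,\forall$, parentheses, and variables $v_0,v_1,\dots$): every symbol is given a word over $X_i$ (computably in $n$ for $v_n$), a formula is written by concatenating the words of its symbols, the word of $v_n$ has length at most $(1+o(1))\log_i n$, and there is a (possibly empty) end marker $e\in X_i^*$ such that for distinct formulas, written as $x$ and $x'$, the string $xe$ is never a prefix of $x'e$. A *theory* $\mathcal F$ is a set of sentences of this language, the axioms, that is computably enumerable (as a set of strings over $X_i$), consistent, sound (it proves only sentences true in $\mathbb N$) and strong enough to formalize arithmetic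 (it proves the axioms of Robinson arithmetic). For $x\in X_i^*$, $\mathcal F\vdash x$ means that $x$ is the written form of a sentence provable in first-order logic with equality from the axioms of $\mathcal F$. A computable function $\hat\rho_i:\mathbb N\times\mathbb N\to\mathbb Q$ assigns to each Gödel numbering $g$ the measure $\rho_g(u)=\hat\rho_i(H_2(g(u)),|u|_i)$, $u\in X_i^*$. It defines an *acceptable complexity measure* if for every Gödel numbering $g$: (1) for every theory $\mathcal F$ there is an integer $N_{\mathcal F}$ such that $\rho_g(x)<N_{\mathcal F}$ whenever $\mathcal F\vdash x$; (2) for every integer $N$, $\lim_{n\to\infty} i^{-n}\cdot\#\{x\in X_i^* : |x|_i=n,\ \rho_g(x)\le N\}=0$; (3) for every Gödel numbering $g'$ there is a constant $c$ with $|\rho_g(u)-\rho_{g'}(u)|\le c$ for all $u\in X_i^*$. **Proposition.** Let $f:\mathbb R\times\mathbb R\to\mathbb R$ be linear in each of its two variables, constant terms allowed (that is, for each fixed value of one variable, $f$ is a polynomial of degree at most $1$ in the other), and suppose that $\hat\rho_i(x,y)=\lfloor f(x,y)\rfloor$, $x,y\in\mathbb N$, is computable. If $\hat\rho_i$ defines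 an acceptable complexity measure, then there are real numbers $a,b,\epsilon$ with $a>0$ and $\tfrac12\le\epsilon\le1$ such that for all $x,y\in\mathbb N$ $$\hat\rho_i(x,y)=\lfloor a\,(x-\epsilon\cdot\log_2(i)\cdot y)+b\rfloor .$$ -/

import Mathlib

open Filter Topology

/-! ### Program-size complexity -/

/-- A self-delimiting machine over the alphabet `X_i = Fin i`: a partial computable function on
strings whose domain is prefix-free. -/
structure Machine (i : ℕ) where
  run : List (Fin i) →. List (Fin i)
  partrec : Partrec run
  prefixFree : ∀ x y, (run x).Dom → (run y).Dom → x <+: y → x = y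

/-- `H_{i,T}(x)`, the least length of a program `y` with `T(y) = x` (`⊤` if there is none). -/
noncomputable def Machine.H {i : ℕ} (T : Machine i) (x : List (Fin i)) : ℕ∞ :=
  ⨅ y ∈ {y | x ∈ T.run y}, (y.length : ℕ∞)

/-- `U` minimises the program-size complexity up to an additive constant. -/
def Machine.IsUniversal {i : ℕ} (U : Machine i) : Prop :=
  ∀ T : Machine i, ∃ c : ℕ, ∀ x, U.H x ≤ T.H x + c

/-- A Gödel numbering: a computable, one-to-one function from `X_i^*` to `X_2^*`. -/
structure GodelNumbering (i : ℕ) where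
  num : List (Fin i) → List (Fin 2)
  computable : Computable num
  injective : Function.Injective num

/-! ### First-order arithmetic -/

namespace Arith

inductive Term where
  | var (n : ℕ)
  | zero
  | succ (t : Term)
  | add (t u : Term)
  | mul (t u : Term)

inductive Formula where
  | eq (t u : Term)
  | neg (φ : Formula)
  | imp (φ ψ : Formula)
  | all (n : ℕ) (φ : Formula)

def Formula.ex (n : ℕ) (φ : Formula) : Formula := .neg (.all n (.neg φ))

def Term.vars : Term → Set ℕ
  | .var n => {n}
  | .zero => ∅
  | .succ t => t.vars
  | .add t u => t.vars ∪ u.vars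
  | .mul t u => t.vars ∪ u.vars

def Formula.free : Formula → Set ℕ
  | .eq t u => t.vars ∪ u.vars
  | .neg φ => φ.free
  | .imp φ ψ => φ.free ∪ ψ.free
  | .all n φ => φ.free \ {n}

def Formula.IsSentence (φ : Formula) : Prop := φ.free = ∅

/-- `t.subst n s` is `t[s / v_n]`. -/
def Term.subst : Term → ℕ → Term → Term
  | .var m, n, s => if m = n then s else .var m
  | .zero, _, _ => .zero
  | .succ t, n, s => .succ (t.subst n s)
  | .add t u, n, s => .add (t.subst n s) (u.subst n s)
  | .mul t u, n, s => .mul (t.subst n s) (u.subst n s)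

/-- `φ.subst n s` replaces the free occurrences of `v_n` in `φ` by `s`. -/
def Formula.subst (n : ℕ) (s : Term) : Formula → Formula
  | .eq t u => .eq (t.subst n s) (u.subst n s)
  | .neg φ => .neg (φ.subst n s)
  | .imp φ ψ => .imp (φ.subst n s) (ψ.subst n s)
  | .all m φ => if m = n then .all m φ else .all m (φ.subst n s)

/-- The term `s` is free for `v_n` in the formula: no variable of `s` gets captured when `s` is
substituted for `v_n`. -/
def Formula.FreeFor (n : ℕ) (s : Term) : Formula → Prop
  | .eq _ _ => True
  | .neg φ => φ.FreeFor n s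
  | .imp φ ψ => φ.FreeFor n s ∧ ψ.FreeFor n s
  | .all m φ => n ∉ (Formula.all m φ).free ∨ (m ∉ s.vars ∧ φ.FreeFor n s)

/-- Provability from the set `A` of nonlogical hypotheses, in a standard Hilbert calculus for
first-order logic with equality. -/
inductive Provable (A : Set Formula) : Formula → Prop
  | hyp {φ : Formula} : φ ∈ A → Provable A φ
  | weaken (φ ψ : Formula) : Provable A (.imp φ (.imp ψ φ))
  | distrib (φ ψ χ : Formula) :
      Provable A (.imp (.imp φ (.imp ψ χ)) (.imp (.imp φ ψ) (.imp φ χ)))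
  | contra (φ ψ : Formula) : Provable A (.imp (.imp (.neg φ) (.neg ψ)) (.imp ψ φ))
  | inst (n : ℕ) (φ : Formula) (t : Term) : φ.FreeFor n t → Provable A (.imp (.all n φ) (φ.subst n t))
  | allImp (n : ℕ) (φ ψ : Formula) : n ∉ φ.free →
      Provable A (.imp (.all n (.imp φ ψ)) (.imp φ (.all n ψ)))
  | eqRefl (t : Term) : Provable A (.eq t t)
  | eqSubst (n : ℕ) (φ : Formula) (s t : Term) : φ.FreeFor n s → φ.FreeFor n t →
      Provable A (.imp (.eq s t) (.imp (φ.subst n s) (φ.subst n t)))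
  | mp {φ ψ : Formula} : Provable A (.imp φ ψ) → Provable A φ → Provable A ψ
  | gen {φ : Formula} (n : ℕ) : Provable A φ → Provable A (.all n φ)

def Term.eval (v : ℕ → ℕ) : Term → ℕ
  | .var n => v n
  | .zero => 0
  | .succ t => t.eval v + 1
  | .add t u => t.eval v + u.eval v
  | .mul t u => t.eval v * u.eval v

/-- Truth in the standard model `ℕ` under the valuation `v`. -/
def Formula.Holds (v : ℕ → ℕ) : Formula → Prop
  | .eq t u => t.eval v = u.eval v
  | .neg φ => ¬ φ.Holds v
  | .imp φ ψ => φ.Holds v → ψ.Holds v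
  | .all n φ => ∀ k : ℕ, φ.Holds (Function.update v n k)

/-- The axioms of Robinson arithmetic. -/
def robinson : Set Formula :=
  let x : Term := .var 0
  let y : Term := .var 1
  { .all 0 (.neg (.eq (.succ x) .zero)),
    .all 0 (.all 1 (.imp (.eq (.succ x) (.succ y)) (.eq x y))),
    .all 0 (.imp (.neg (.eq x .zero)) (.ex 1 (.eq x (.succ y)))),
    .all 0 (.eq (.add x .zero) x),
    .all 0 (.all 1 (.eq (.add x (.succ y)) (.succ (.add x y)))),
    .all 0 (.eq (.mul x .zero) .zero),
    .all 0 (.all 1 (.eq (.mul x (.succ y)) (.add (.mul x y) x))) }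

/-! ### Writing formulas as strings -/

/-- The typographical symbols. -/
inductive Sym where
  | var (n : ℕ)
  | zero | succ | add | mul | eq | neg | imp | all | lpar | rpar

def Term.symbols : Term → List Sym
  | .var n => [.var n]
  | .zero => [.zero]
  | .succ t => .succ :: t.symbols
  | .add t u => .lpar :: (t.symbols ++ .add :: (u.symbols ++ [.rpar]))
  | .mul t u => .lpar :: (t.symbols ++ .mul :: (u.symbols ++ [.rpar]))

def Formula.symbols : Formula → List Sym
  | .eq t u => t.symbols ++ .eq :: u.symbols
  | .neg φ => .neg :: φ.symbols
  | .imp φ ψ => .lpar :: (φ.symbols ++ .imp :: (ψ.symbols ++ [.rpar]))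
  | .all n φ => .all :: .var n :: φ.symbols

/-- A way of writing the formulas of arithmetic as strings over `X_i`, symbol by symbol.
The words of the variables are computable, and an identifier takes essentially as many letters as
its number has digits in base `i`. There is an end marker (possibly empty): no formula followed by
the marker is a proper prefix of another one; in particular, distinct formulas are written
differently. -/
structure Script (i : ℕ) where
  word : Sym → List (Fin i)
  computable : Computable fun n : ℕ => word (.var n)
  varLength : ∀ η : ℝ, 0 < η →
    ∀ᶠ n : ℕ in atTop, ((word (.var n)).length : ℝ) ≤ (1 + η) * Real.logb i n
  endMarker : ∃ e : List (Fin i), ∀ φ ψ : Formula,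
    φ.symbols.flatMap word ++ e <+: ψ.symbols.flatMap word ++ e → φ = ψ

def Script.write {i : ℕ} (L : Script i) (φ : Formula) : List (Fin i) :=
  φ.symbols.flatMap L.word

/-- A theory that satisfies the hypotheses of Gödel's incompleteness theorem: finitely specified
(its set `A` of axioms, written as strings, is computably enumerable), consistent, sound, and
strong enough to formalize arithmetic. -/
structure GodelTheory {i : ℕ} (L : Script i) where
  A : Set Formula
  sentences : ∀ φ ∈ A, φ.IsSentence
  enumerable : REPred fun s : List (Fin i) => ∃ φ ∈ A, L.write φ = s
  consistent : ¬ ∃ φ, Provable A φ ∧ Provable A (.neg φ)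
  sound : ∀ φ : Formula, φ.IsSentence → Provable A φ → ∀ v, φ.Holds v
  arithmetic : ∀ φ ∈ robinson, Provable A φ

/-- The theorems of the theory, written in the alphabet `X_i`. -/
def GodelTheory.theorems {i : ℕ} {L : Script i} (F : GodelTheory L) : Set (List (Fin i)) :=
  {s | ∃ φ : Formula, φ.IsSentence ∧ Provable F.A φ ∧ L.write φ = s}

end Arith

/-! ### Acceptable complexity measures -/

/-- Computability of a function `ℕ × ℕ → ℚ`, through a fraction that represents the value. -/
def ComputableRat (r : ℕ → ℕ → ℚ) : Prop :=
  ∃ p q d : ℕ → ℕ → ℕ, Computable₂ p ∧ Computable₂ q ∧ Computable₂ d ∧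
    ∀ x y, r x y = ((p x y : ℚ) - q x y) / (d x y + 1)

/-- The measure `ρ_g(u) = r(H_2(g(u)), |u|)` that the builder with witness `r` assigns to `g`.
For a universal machine `U` the complexity is finite, so that `toNat` does not change it. -/
noncomputable def builder {i : ℕ} (U : Machine 2) (r : ℕ → ℕ → ℚ) (g : GodelNumbering i)
    (u : List (Fin i)) : ℚ :=
  r (U.H (g.num u)).toNat u.length

/-- The builder with witness `r` is acceptable. -/
structure Acceptable {i : ℕ} (L : Arith.Script i) (U : Machine 2) (r : ℕ → ℕ → ℚ) : Prop where
  bound : ∀ (g : GodelNumbering i) (F : Arith.GodelTheory L), ∃ N : ℤ,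
    ∀ x ∈ F.theorems, builder U r g x < N
  lim : ∀ (g : GodelNumbering i) (N : ℤ),
    Tendsto (fun n : ℕ =>
      ({x : List (Fin i) | x.length = n ∧ builder U r g x ≤ N}.ncard : ℝ) / (i : ℝ) ^ n)
      atTop (𝓝 0)
  inva : ∀ g g' : GodelNumbering i, ∃ c : ℚ, ∀ u : List (Fin i),
    |builder U r g u - builder U r g' u| ≤ c

/-- `f` is linear (in the sense of a polynomial of degree at most one, constant term allowed) in
each of its two variables. -/
def LinearInBoth (f : ℝ → ℝ → ℝ) : Prop :=
  (∀ y, ∃ p q : ℝ, ∀ x, f x y = p * x + q) ∧ (∀ x, ∃ p q : ℝ, ∀ y, f x y = p * y + q)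

namespace Arith

theorem Term.eval_congr {v w : ℕ → ℕ} (t : Term) (h : ∀ n ∈ t.vars, v n = w n) :
    t.eval v = t.eval w := by
  induction t with
  | var n => exact h n rfl
  | zero => rfl
  | succ t ih => simp only [Term.eval, ih h]
  | add t u iht ihu =>
    simp only [Term.eval, iht fun n hn => h n (.inl hn), ihu fun n hn => h n (.inr hn)]
  | mul t u iht ihu =>
    simp only [Term.eval, iht fun n hn => h n (.inl hn), ihu fun n hn => h n (.inr hn)]

theorem Term.eval_subst (v : ℕ → ℕ) (t : Term) (n : ℕ) (s : Term) :
    (t.subst n s).eval v = t.eval (Function.update v n (s.eval v)) := by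
  induction t with
  | var m => by_cases h : m = n <;> simp [Term.subst, Term.eval, h]
  | zero => rfl
  | succ t ih => simp only [Term.subst, Term.eval, ih]
  | add t u iht ihu => simp only [Term.subst, Term.eval, iht, ihu]
  | mul t u iht ihu => simp only [Term.subst, Term.eval, iht, ihu]

theorem Term.subst_of_notMem_vars (t : Term) {n : ℕ} (s : Term) (h : n ∉ t.vars) :
    t.subst n s = t := by
  induction t with
  | var m => exact if_neg fun e => h e.symm
  | zero => rfl
  | succ t ih => simp only [Term.subst, ih h]
  | add t u iht ihu =>
    simp only [Term.subst, iht fun e => h (.inl e), ihu fun e => h (.inr e)]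
  | mul t u iht ihu =>
    simp only [Term.subst, iht fun e => h (.inl e), ihu fun e => h (.inr e)]

theorem Formula.holds_congr (φ : Formula) {v w : ℕ → ℕ} (h : ∀ n ∈ φ.free, v n = w n) :
    φ.Holds v ↔ φ.Holds w := by
  induction φ generalizing v w with
  | eq t u =>
    simp only [Formula.Holds, t.eval_congr fun n hn => h n (.inl hn),
      u.eval_congr fun n hn => h n (.inr hn)]
  | neg φ ih => exact not_congr (ih h)
  | imp φ ψ ih₁ ih₂ =>
    exact imp_congr (ih₁ fun n hn => h n (.inl hn)) (ih₂ fun n hn => h n (.inr hn))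
  | all m φ ih =>
    refine forall_congr' fun k => ih fun n hn => ?_
    by_cases e : n = m
    · simp [e]
    · simpa [e] using h n ⟨hn, e⟩

theorem Formula.subst_of_notMem_free (φ : Formula) {n : ℕ} (s : Term) (h : n ∉ φ.free) :
    φ.subst n s = φ := by
  induction φ with
  | eq t u =>
    simp only [Formula.subst, t.subst_of_notMem_vars s fun e => h (.inl e),
      u.subst_of_notMem_vars s fun e => h (.inr e)]
  | neg φ ih => simp only [Formula.subst, ih h]
  | imp φ ψ ih₁ ih₂ =>
    simp only [Formula.subst, ih₁ fun e => h (.inl e), ih₂ fun e => h (.inr e)]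
  | all m φ ih =>
    by_cases e : m = n
    · simp [Formula.subst, e]
    · simp [Formula.subst, e, ih fun hn => h ⟨hn, fun e' => e e'.symm⟩]

theorem Formula.holds_subst (φ : Formula) {n : ℕ} {s : Term} (h : φ.FreeFor n s) (v : ℕ → ℕ) :
    (φ.subst n s).Holds v ↔ φ.Holds (Function.update v n (s.eval v)) := by
  induction φ generalizing v with
  | eq t u => simp only [Formula.subst, Formula.Holds, Term.eval_subst]
  | neg φ ih => exact not_congr (ih h v)
  | imp φ ψ ih₁ ih₂ => exact imp_congr (ih₁ h.1 v) (ih₂ h.2 v)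
  | all m φ ih =>
    by_cases hn : n ∈ (Formula.all m φ).free
    · obtain ⟨hm, hφ⟩ := h.resolve_left (not_not_intro hn)
      have hmn : m ≠ n := fun e => hn.2 e.symm
      rw [Formula.subst, if_neg hmn]
      refine forall_congr' fun k => ?_
      rw [ih hφ, Function.update_comm hmn,
        s.eval_congr (v := Function.update v m k) (w := v) fun j hj =>
          Function.update_of_ne (fun e : j = m => hm (e ▸ hj)) _ _]
    · rw [Formula.subst_of_notMem_free _ _ hn]
      refine Formula.holds_congr _ fun j hj => ?_
      rw [Function.update_of_ne fun e : j = n => hn (e ▸ hj)]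

theorem Provable.holds {A : Set Formula} (hA : ∀ φ ∈ A, ∀ v, φ.Holds v) {φ : Formula}
    (h : Provable A φ) (v : ℕ → ℕ) : φ.Holds v := by
  induction h generalizing v with
  | hyp h => exact hA _ h v
  | weaken φ ψ => exact fun a _ => a
  | distrib φ ψ χ => exact fun f g a => f a (g a)
  | contra φ ψ => exact fun f b => by_contra fun a => f a b
  | inst n φ t h => exact fun a => (φ.holds_subst h v).2 (a _)
  | allImp n φ ψ h =>
    exact fun a b k => a k ((φ.holds_congr fun j hj =>
      Function.update_of_ne (fun e : j = n => h (e ▸ hj)) _ _).2 b)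
  | eqRefl t => rfl
  | eqSubst n φ s t hs ht =>
    intro (e : s.eval v = t.eval v) a
    rw [Formula.holds_subst _ hs, e] at a
    exact (φ.holds_subst ht v).2 a
  | mp _ _ ih₁ ih₂ => exact ih₁ v (ih₂ v)
  | gen n _ ih => exact fun k => ih _

theorem robinson_holds : ∀ φ ∈ robinson, ∀ v, φ.Holds v := by
  intro φ hφ v
  simp only [robinson, Set.mem_insert_iff, Set.mem_singleton_iff] at hφ
  rcases hφ with rfl | rfl | rfl | rfl | rfl | rfl | rfl <;>
    simp [Formula.Holds, Formula.ex, Term.eval, Nat.mul_succ, ← add_assoc]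
  exact fun a h => Nat.pos_of_ne_zero h

theorem robinson_isSentence : ∀ φ ∈ robinson, φ.IsSentence := by
  intro φ hφ
  simp only [robinson, Set.mem_insert_iff, Set.mem_singleton_iff] at hφ
  rcases hφ with rfl | rfl | rfl | rfl | rfl | rfl | rfl <;>
    ext n <;> simp [Formula.free, Formula.ex, Term.vars]

theorem primrecPred_mem_of_finite {α : Type*} [Primcodable α] {s : Set α} (hs : s.Finite) :
    PrimrecPred (· ∈ s) := by
  induction s, hs using Set.Finite.induction_on with
  | empty => exact (PrimrecPred.not (Primrec.eq.comp .id .id)).of_eq fun a => by simp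
  | @insert a s _ _ ih => exact (PrimrecPred.or (Primrec.eq.comp .id (.const a)) ih)

theorem Script.write_injective {i : ℕ} (L : Script i) : Function.Injective L.write := by
  obtain ⟨e, he⟩ := L.endMarker
  intro φ ψ h
  apply he
  change L.write φ ++ e <+: L.write ψ ++ e
  rw [h]

/-- Robinson arithmetic, as a theory. -/
def robinsonTheory {i : ℕ} (L : Script i) : GodelTheory L where
  A := robinson
  sentences := robinson_isSentence
  enumerable := by
    have hfin : (L.write '' robinson).Finite := by
      refine Set.Finite.image _ ?_
      simp only [robinson]
      exact Set.toFinite _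
    exact ComputablePred.to_re (primrecPred_mem_of_finite hfin).computablePred
  consistent := fun ⟨_, h, h'⟩ =>
    h'.holds robinson_holds (fun _ => 0) (h.holds robinson_holds _)
  sound := fun _ _ h v => h.holds robinson_holds v
  arithmetic := fun _ h => .hyp h

theorem all_zero_eq_zero_mem_theorems {i : ℕ} {L : Script i} (F : GodelTheory L) (n : ℕ) :
    L.write (.all n (.eq .zero .zero)) ∈ F.theorems :=
  ⟨_, by simp [Formula.IsSentence, Formula.free, Term.vars], .gen n (.eqRefl _), rfl⟩

theorem Script.exists_length_le {i : ℕ} (L : Script i) :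
    ∃ C : ℕ, ∀ᶠ n : ℕ in atTop,
      ((L.write (.all n (.eq .zero .zero))).length : ℝ) ≤ 2 * Real.logb i n + C := by
  refine ⟨(L.word .all).length + (L.word .zero).length * 2 + (L.word .eq).length, ?_⟩
  filter_upwards [L.varLength 1 one_pos] with n hn
  simp [Script.write, Formula.symbols, Term.symbols]
  linarith

end Arith

/-- The machine that outputs its input, if it is a code word of a prefix code. -/
def Machine.ofPrefixCode {i : ℕ} {α : Type*} [Primcodable α] (c : α → List (Fin i))
    (hc : Computable c) (hp : ∀ a b, c a <+: c b → a = b) : Machine i where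
  run p := Nat.rfindOpt fun n =>
    (Encodable.decode (α := α) n).bind fun a => if c a = p then some p else none
  partrec := by
    refine Partrec.rfindOpt ?_
    refine Computable.option_bind (Computable.decode.comp .snd) ?_
    have h : Primrec fun q : List (Fin i) × List (Fin i) =>
        if q.1 = q.2 then some q.2 else none :=
      .ite (Primrec.eq.comp .fst .snd) (Primrec.option_some.comp .snd) (.const none)
    exact h.to_comp.comp ((hc.comp .snd).pair (Computable.fst.comp .fst))
  prefixFree := by
    have key : ∀ p, (Nat.rfindOpt fun n => (Encodable.decode (α := α) n).bind fun a =>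
        if c a = p then some p else none).Dom → ∃ a, c a = p := by
      intro p h
      obtain ⟨n, x, hx⟩ := Nat.rfindOpt_dom.1 h
      simp only [Option.mem_def, Option.bind_eq_some_iff] at hx
      obtain ⟨a, -, ha⟩ := hx
      exact ⟨a, by_contra fun e => by simp [e] at ha⟩
    intro x y hx hy h
    obtain ⟨a, rfl⟩ := key x hx
    obtain ⟨b, rfl⟩ := key y hy
    rw [hp a b h]

theorem Machine.mem_run_ofPrefixCode {i : ℕ} {α : Type*} [Primcodable α] (c : α → List (Fin i))
    (hc : Computable c) (hp : ∀ a b, c a <+: c b → a = b) (a : α) :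
    c a ∈ (Machine.ofPrefixCode c hc hp).run (c a) := by
  have hd : ((Machine.ofPrefixCode c hc hp).run (c a)).Dom :=
    Nat.rfindOpt_dom.2 ⟨Encodable.encode a, c a, by simp⟩
  refine ⟨hd, ?_⟩
  obtain ⟨n, hn⟩ := Nat.rfindOpt_spec ⟨hd, rfl⟩
  simp only [Option.mem_def, Option.bind_eq_some_iff] at hn
  obtain ⟨b, -, hb⟩ := hn
  split_ifs at hb
  exact (Option.some.inj hb).symm

theorem Machine.H_le {i : ℕ} {T : Machine i} {x y : List (Fin i)} (h : x ∈ T.run y) :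
    T.H x ≤ y.length :=
  iInf₂_le (f := fun (y : List (Fin i)) (_ : y ∈ {y | x ∈ T.run y}) => (y.length : ℕ∞)) y h

theorem Machine.IsUniversal.exists_H_le_length {i : ℕ} {U : Machine i} (hU : U.IsUniversal)
    {α : Type*} [Primcodable α] {c : α → List (Fin i)} (hc : Computable c)
    (hp : ∀ a b, c a <+: c b → a = b) : ∃ C : ℕ, ∀ a, U.H (c a) ≤ ((c a).length + C : ℕ) := by
  obtain ⟨C, hC⟩ := hU (.ofPrefixCode c hc hp)
  refine ⟨C, fun a => (hC _).trans ?_⟩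
  push_cast
  gcongr
  exact Machine.H_le (Machine.mem_run_ofPrefixCode c hc hp a)

theorem Machine.exists_program {i : ℕ} (T : Machine i) {x : List (Fin i)} {k : ℕ}
    (h : T.H x < k) : ∃ y, x ∈ T.run y ∧ y.length < k := by
  simp only [Machine.H, iInf_lt_iff] at h
  obtain ⟨y, hy, hk⟩ := h
  exact ⟨y, hy, by exact_mod_cast hk⟩

/-- There are fewer than `2 ^ k` strings of complexity less than `k`. -/
theorem Machine.card_H_lt {α : Type*} (T : Machine 2) {h : α → List (Fin 2)}
    (hh : Function.Injective h) (s : Finset α) (k : ℕ) (hs : ∀ a ∈ s, T.H (h a) < k) :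
    s.card < 2 ^ k := by
  choose! p hp hk using fun a ha => T.exists_program (hs a ha)
  have hlt : ∑ m ∈ Finset.range k, 2 ^ m < 2 ^ k := by
    rw [Nat.geomSum_eq le_rfl]
    have := Nat.pos_of_ne_zero (pow_ne_zero k (two_ne_zero (α := ℕ)))
    omega
  refine lt_of_le_of_lt ?_ hlt
  classical
  have hcard : ∀ m, (Finset.univ : Finset (List.Vector (Fin 2) m)).card = 2 ^ m := by
    intro m; simp
  simp only [← hcard]
  rw [← Finset.card_sigma]
  refine Finset.card_le_card_of_injOn (fun a => ⟨(p a).length, ⟨p a, rfl⟩⟩) ?_ ?_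
  · intro a ha
    simpa using hk a ha
  · intro a ha b hb e
    have e' : p a = p b :=
      congrArg (fun z : Σ m, List.Vector (Fin 2) m => z.2.toList) e
    exact hh (Part.mem_unique (hp a ha) (e' ▸ hp b hb))

/-! ### An efficient prefix code -/

theorem List.replicate_append_cons_prefix {α : Type*} {x y : α} (hxy : x ≠ y) {m n : ℕ}
    {s t : List α} (h : List.replicate m x ++ y :: s <+: List.replicate n x ++ y :: t) :
    m = n ∧ s <+: t := by
  induction m generalizing n with
  | zero =>
    cases n with
    | zero => simpa using h
    | succ n => simp [List.replicate_succ, hxy.symm] at h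
  | succ m ih =>
    cases n with
    | zero => simp [List.replicate_succ, hxy] at h
    | succ n =>
      simp only [List.replicate_succ, List.cons_append, List.cons_prefix_cons, true_and] at h
      simpa using ih h

/-- The number with the digits `u`, least significant first. -/
def digitsValue {i : ℕ} (u : List (Fin i)) : ℕ := u.foldr (fun (d : Fin i) v => (d : ℕ) + i * v) 0

theorem digitsValue_lt {i : ℕ} (u : List (Fin i)) : digitsValue u < i ^ u.length := by
  induction u with
  | nil => simp [digitsValue]
  | cons d u ih =>
    change d + i * digitsValue u < i ^ (u.length + 1)
    calc (d : ℕ) + i * digitsValue u < i * (digitsValue u + 1) := by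
          rw [mul_add, mul_one, add_comm]; gcongr; exact d.2
      _ ≤ i ^ (u.length + 1) := by rw [pow_succ']; gcongr; exact ih

theorem digitsValue_inj {i : ℕ} {u v : List (Fin i)} (hl : u.length = v.length)
    (h : digitsValue u = digitsValue v) : u = v := by
  induction u generalizing v with
  | nil => exact (List.length_eq_zero_iff.1 hl.symm).symm
  | cons d u ih =>
    obtain _ | ⟨e, v⟩ := v
    · simp at hl
    change d + i * digitsValue u = e + i * digitsValue v at h
    have hde : (d : ℕ) = e := by
      have := congrArg (· % i) h
      simpa [Nat.mod_eq_of_lt d.2, Nat.mod_eq_of_lt e.2] using this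
    have hi : 0 < i := d.pos
    rw [hde, Nat.add_left_cancel_iff, Nat.mul_right_inj hi.ne'] at h
    rw [Fin.ext hde, ih (by simpa using hl) h]

/-- The first `m` binary digits of `v`, least significant first. -/
def lowBits (m v : ℕ) : List (Fin 2) :=
  (List.range m).map fun k => if v / 2 ^ k % 2 = 1 then 1 else 0

theorem lowBits_inj {m v w : ℕ} (hv : v < 2 ^ m) (hw : w < 2 ^ m)
    (h : lowBits m v = lowBits m w) : v = w := by
  refine Nat.eq_of_testBit_eq fun k => ?_
  by_cases hk : k < m
  · have := List.map_inj_left.1 h k (List.mem_range.2 hk)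
    simp only [Nat.testBit_eq_decide_div_mod_eq]
    split_ifs at this with h₁ h₂ h₂ <;> simp_all
  · have hm : 2 ^ m ≤ 2 ^ k := Nat.pow_le_pow_right two_pos (not_lt.1 hk)
    rw [Nat.testBit_lt_two_pow (hv.trans_le hm), Nat.testBit_lt_two_pow (hw.trans_le hm)]

/-- The length `n` of `u`, as `1 ^ (n / M) 0 1 ^ (n % M) 0`, followed by the number with the
digits `u` in binary. -/
def blockCode (i M : ℕ) (u : List (Fin i)) : List (Fin 2) :=
  List.replicate (u.length / M) 1 ++ 0 :: (List.replicate (u.length % M) 1 ++ 0 ::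
    lowBits (Nat.log 2 (i ^ u.length) + 1) (digitsValue u))

theorem blockCode_prefix {i M : ℕ} (u v : List (Fin i))
    (h : blockCode i M u <+: blockCode i M v) : u = v := by
  have h10 : (1 : Fin 2) ≠ 0 := by decide
  obtain ⟨hd, h⟩ := List.replicate_append_cons_prefix h10 h
  obtain ⟨hm, h⟩ := List.replicate_append_cons_prefix h10 h
  have hl : u.length = v.length := by
    rw [← Nat.div_add_mod u.length M, hd, hm, Nat.div_add_mod]
  rw [hl] at h
  have e := h.eq_of_length (by simp [lowBits])
  have hlt : i ^ v.length < 2 ^ (Nat.log 2 (i ^ v.length) + 1) :=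
    Nat.lt_pow_succ_log_self one_lt_two _
  exact digitsValue_inj hl (lowBits_inj ((hl ▸ digitsValue_lt u).trans hlt)
    ((digitsValue_lt v).trans hlt) e)

theorem Primrec.nat_const_pow {α : Type*} [Primcodable α] {f : α → ℕ} (hf : Primrec f) (b : ℕ) :
    Primrec fun a => b ^ f a :=
  (Primrec.nat_rec' (h := fun _ p => p.2 * b) hf (.const 1)
    (Primrec.nat_mul.comp (Primrec.snd.comp .snd) (.const b))).of_eq fun a => by
      induction f a with
      | zero => rfl
      | succ n ih => exact (congrArg (· * b) ih).trans (pow_succ b n).symm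

theorem Primrec.nat_log_two {α : Type*} [Primcodable α] {f : α → ℕ} (hf : Primrec f) :
    Primrec fun a => Nat.log 2 (f a) := by
  have hp : PrimrecRel fun (a : α) (k : ℕ) => 2 ^ k ≤ f a :=
    Primrec.nat_le.comp (Primrec.nat_const_pow .snd 2) (hf.comp .fst)
  refine (Primrec.nat_findGreatest hf hp).of_eq fun a => ?_
  rw [Nat.findGreatest_eq_iff]
  refine ⟨Nat.log_le_self 2 _, fun h => Nat.pow_log_le_self 2 fun h0 => h (by simp [h0]),
    fun n hn _ => not_le.2 (Nat.lt_pow_of_log_lt one_lt_two hn)⟩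

theorem primrec_lowBits : Primrec₂ lowBits :=
  Primrec.list_map (Primrec.list_range.comp .fst) <| Primrec.ite
    (Primrec.eq.comp (Primrec.nat_mod.comp (Primrec.nat_div.comp (Primrec.snd.comp .fst)
      (Primrec.nat_const_pow .snd 2)) (.const 2)) (.const 1)) (.const 1) (.const 0)

theorem primrec_digitsValue (i : ℕ) : Primrec (digitsValue (i := i)) := by
  have h : Primrec₂ fun (_ : List (Fin i)) (p : Fin i × ℕ) => (p.1 : ℕ) + i * p.2 :=
    Primrec.nat_add.comp (Primrec.fin_val.comp (Primrec.fst.comp .snd))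
      (Primrec.nat_mul.comp (.const i) (Primrec.snd.comp .snd))
  exact (Primrec.list_foldr .id (.const 0) h).of_eq fun _ => rfl

theorem Primrec.list_replicate {α β : Type*} [Primcodable α] [Primcodable β] {f : α → ℕ}
    (hf : Primrec f) (b : β) : Primrec fun a => List.replicate (f a) b :=
  (Primrec.list_map (Primrec.list_range.comp hf) (Primrec.const b).to₂).of_eq fun a => by
    simp

theorem computable_blockCode (i M : ℕ) : Computable (blockCode i M) := by
  have hl : Primrec (List.length (α := Fin i)) := .list_length
  refine Primrec.to_comp <| Primrec.list_append.comp
    (.list_replicate (Primrec.nat_div.comp hl (.const M)) 1) <|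
    Primrec.list_cons.comp (.const 0) <| Primrec.list_append.comp
    (.list_replicate (Primrec.nat_mod.comp hl (.const M)) 1) <|
    Primrec.list_cons.comp (.const 0) <| primrec_lowBits.comp
    (Primrec.succ.comp (.nat_log_two (.nat_const_pow hl i))) (primrec_digitsValue i)

theorem length_blockCode_le {i M : ℕ} (hM : 0 < M) (u : List (Fin i)) :
    ((blockCode i M u).length : ℝ) ≤ (Real.logb 2 i + 1 / M) * u.length + (M + 3) := by
  have h1 : ((u.length / M : ℕ) : ℝ) ≤ u.length / M := Nat.cast_div_le
  have h2 : ((u.length % M : ℕ) : ℝ) ≤ M := by exact_mod_cast (Nat.mod_lt _ hM).le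
  have h3 : (Nat.log 2 (i ^ u.length) : ℝ) ≤ u.length * Real.logb 2 i := by
    have := Real.natLog_le_logb (i ^ u.length) 2
    simpa [Real.logb_pow] using this
  simp only [blockCode, lowBits, List.length_append, List.length_replicate, List.length_cons,
    List.length_map, List.length_range]
  push_cast
  have : (1 / M : ℝ) * u.length = u.length / M := by ring
  rw [add_mul, this]
  linarith

theorem LinearInBoth.exists_coeffs {f : ℝ → ℝ → ℝ} (hf : LinearInBoth f) :
    ∃ α β γ δ : ℝ, ∀ x y, f x y = α * x * y + β * x + γ * y + δ := by
  obtain ⟨p₀, q₀, h₀⟩ := hf.2 0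
  obtain ⟨p₁, q₁, h₁⟩ := hf.2 1
  refine ⟨p₁ - p₀, q₁ - q₀, p₀, q₀, fun x y => ?_⟩
  obtain ⟨p, q, h⟩ := hf.1 y
  have e₀ := (h 0).symm.trans (h₀ y)
  have e₁ := (h 1).symm.trans (h₁ y)
  have hq : q = p₀ * y + q₀ := by linarith
  have hp : p = p₁ * y + q₁ - (p₀ * y + q₀) := by linarith
  rw [h, hp, hq]
  ring

/-- An almost optimal Gödel numbering. -/
theorem Machine.IsUniversal.exists_godelNumbering {U : Machine 2} (hU : U.IsUniversal) (i : ℕ)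
    {η : ℝ} (hη : 0 < η) : ∃ (g : GodelNumbering i) (C : ℝ), ∀ u, U.H (g.num u) ≠ ⊤ ∧
      ((U.H (g.num u)).toNat : ℝ) ≤ (Real.logb 2 i + η) * u.length + C := by
  obtain ⟨m, hm⟩ := exists_nat_one_div_lt hη
  obtain ⟨C, hC⟩ := hU.exists_H_le_length (computable_blockCode i (m + 1)) blockCode_prefix
  refine ⟨⟨blockCode i (m + 1), computable_blockCode i _, fun u v h =>
    blockCode_prefix u v (by rw [h])⟩, (m + 1 : ℕ) + 3 + C, fun u => ⟨?_, ?_⟩⟩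
  · exact ne_top_of_le_ne_top (ENat.natCast_ne_top _) (hC u)
  · have h₁ : ((U.H (blockCode i (m + 1) u)).toNat : ℝ) ≤
        ((blockCode i (m + 1) u).length + C : ℕ) :=
      Nat.cast_le.2 (ENat.toNat_le_of_le_natCast (hC u))
    have h₂ := length_blockCode_le m.succ_pos u
    have h₃ : (1 / (m + 1 : ℕ) : ℝ) * u.length ≤ η * u.length := by
      gcongr; exact_mod_cast hm.le
    push_cast at *
    linarith

/-- Some string of each large length is random and has a large measure. -/
theorem Acceptable.eventually_exists_lt {i : ℕ} (hi : 2 ≤ i) {L : Arith.Script i}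
    {U : Machine 2} {r : ℕ → ℕ → ℚ} (hacc : Acceptable L U r) (g : GodelNumbering i)
    (hg : ∀ u, U.H (g.num u) ≠ ⊤) (N : ℤ) :
    ∀ᶠ n : ℕ in atTop, ∃ u : List (Fin i), u.length = n ∧
      Real.logb 2 i * n - 2 ≤ (U.H (g.num u)).toNat ∧ N < builder U r g u := by
  filter_upwards [(hacc.lim g N).eventually_lt_const (half_pos one_pos),
    eventually_ge_atTop 1] with n hn hn1
  set k := Nat.log 2 (i ^ n) - 1 with hk
  have hin : 2 ≤ i ^ n := hi.trans (Nat.le_self_pow (by omega) i)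
  have hlog : 1 ≤ Nat.log 2 (i ^ n) := Nat.log_pos one_lt_two hin
  have hk2 : 2 ^ k * 2 ≤ i ^ n := by
    rw [← pow_succ, hk, Nat.sub_add_cancel hlog]
    exact Nat.pow_log_le_self 2 (by omega)
  have hkl : Real.logb 2 i * n - 2 ≤ k := by
    have : (i ^ n : ℝ) < 2 ^ (k + 2) := by
      have := Nat.lt_pow_succ_log_self one_lt_two (i ^ n)
      rw [show k + 2 = (Nat.log 2 (i ^ n)).succ by omega]
      exact_mod_cast this
    have h := Real.logb_lt_logb one_lt_two (by positivity) this
    rw [Real.logb_pow, Real.logb_pow, Real.logb_self_eq_one one_lt_two] at h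
    push_cast at h
    linarith
  by_contra! hcon
  classical
  set bad := {x : List (Fin i) | x.length = n ∧ builder U r g x ≤ N} with hbad
  have hfin : bad.Finite := (List.finite_length_eq (Fin i) n).subset fun x hx => hx.1
  let s : Finset (List.Vector (Fin i) n) := Finset.univ.filter fun v => U.H (g.num v.1) < k
  have hs : s.card < 2 ^ k :=
    U.card_H_lt (h := fun v : List.Vector (Fin i) n => g.num v.1)
      (g.injective.comp Subtype.val_injective) s k fun v hv => (Finset.mem_filter.1 hv).2
  have hsc : sᶜ.card ≤ bad.ncard := by
    rw [← Finset.card_image_of_injective (f := fun v : List.Vector (Fin i) n => v.1) _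
      Subtype.val_injective, ← Set.ncard_coe_finset]
    refine Set.ncard_le_ncard (fun x hx => ?_) hfin
    obtain ⟨v, hv, rfl⟩ := Finset.mem_image.1 (Finset.mem_coe.1 hx)
    refine ⟨v.2, hcon _ v.2 (hkl.trans ?_)⟩
    have hv' : (k : ℕ∞) ≤ U.H (g.num v.1) := by
      simpa [s] using hv
    rw [← ENat.natCast_toNat (hg _)] at hv'
    exact_mod_cast hv'
  have htot : s.card + sᶜ.card = i ^ n := by
    rw [Finset.card_add_card_compl]; simp
  have hpos : (0 : ℝ) < (i : ℝ) ^ n := by positivity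
  rw [div_lt_iff₀ hpos] at hn
  have h₁ : (bad.ncard : ℝ) * 2 < (i ^ n : ℕ) := by push_cast; linarith
  have h₂ : bad.ncard * 2 < i ^ n := by exact_mod_cast h₁
  omega

/-- Robinson arithmetic has theorems of high complexity relative to their length. -/
theorem Acceptable.exists_eventually_exists_lt {i : ℕ} (hi : 2 ≤ i) {L : Arith.Script i}
    {U : Machine 2} {r : ℕ → ℕ → ℚ} (hacc : Acceptable L U r) (g : GodelNumbering i)
    (hg : ∀ u, U.H (g.num u) ≠ ⊤) :
    ∃ (N : ℤ) (C : ℝ), ∀ᶠ k : ℕ in atTop, ∃ u : List (Fin i),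
      (k : ℝ) ≤ (U.H (g.num u)).toNat ∧ (u.length : ℝ) ≤ 2 * (k + 1) / Real.logb 2 i + C ∧
        builder U r g u < N := by
  obtain ⟨N, hN⟩ := hacc.bound g (Arith.robinsonTheory L)
  obtain ⟨C, hC⟩ := L.exists_length_le
  obtain ⟨n₀, hn₀⟩ := eventually_atTop.1 hC
  refine ⟨N, C, ?_⟩
  filter_upwards [eventually_ge_atTop n₀] with k hk
  let x : ℕ → List (Fin i) := fun n => L.write (.all n (.eq .zero .zero))
  have hx : Function.Injective x := fun m n h => by
    simpa using L.write_injective h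
  obtain ⟨n, hn, hnk⟩ : ∃ n ∈ Finset.Ico (2 ^ k) (2 ^ (k + 1)), ¬ U.H (g.num (x n)) < k := by
    by_contra! h
    have := U.card_H_lt (h := fun n => g.num (x n)) (g.injective.comp hx) _ k h
    rw [Nat.card_Ico, pow_succ] at this
    omega
  rw [Finset.mem_Ico] at hn
  have hpos : 0 < n := (pow_pos two_pos k).trans_le hn.1
  refine ⟨x n, ?_, ?_, hN _ (Arith.all_zero_eq_zero_mem_theorems _ n)⟩
  · rw [not_lt, ← ENat.natCast_toNat (hg _)] at hnk
    exact_mod_cast hnk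
  · refine (hn₀ n ((hk.trans Nat.lt_two_pow_self.le).trans hn.1)).trans ?_
    have hl : 0 < Real.logb 2 i := Real.logb_pos one_lt_two (by exact_mod_cast hi)
    have h : Real.logb 2 n ≤ k + 1 := by
      rw [Real.logb_le_iff_le_rpow one_lt_two (by exact_mod_cast hpos)]
      exact_mod_cast hn.2.le
    have hb : Real.logb i n = Real.logb 2 n / Real.logb 2 i :=
      (div_div_div_cancel_right₀ (Real.log_pos one_lt_two).ne' _ _).symm
    rw [hb, mul_div_assoc]
    gcongr

theorem coeffs_of_bounds {ℓ α β γ δ : ℝ} (hℓ : 1 ≤ ℓ)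
    (H : ∀ η : ℝ, 0 < η → ∃ C N C' : ℝ,
      (∀ N : ℤ, ∀ᶠ n : ℕ in atTop, ∃ h : ℝ, ℓ * n - 2 ≤ h ∧ h ≤ (ℓ + η) * n + C ∧
        N < α * h * n + β * h + γ * n + δ) ∧
      (∀ᶠ k : ℕ in atTop, ∃ h y : ℝ, 0 ≤ y ∧ k ≤ h ∧ h ≤ (ℓ + η) * y + C ∧
        y ≤ 2 * (k + 1) / ℓ + C' ∧ α * h * y + β * h + γ * y + δ < N)) :
    α = 0 ∧ 0 < β ∧ γ ≤ -(β * ℓ) / 2 ∧ -(β * ℓ) ≤ γ := by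
  have large : ∀ X : ℝ, ∀ᶠ n : ℕ in atTop, X ≤ n := fun X =>
    tendsto_natCast_atTop_atTop.eventually_ge_atTop X
  have key₁ : ∀ η : ℝ, 0 < η → ∃ C : ℝ, ∀ N X : ℝ, ∃ n h : ℝ, X ≤ n ∧ 0 ≤ n ∧
      ℓ * n - 2 ≤ h ∧ h ≤ (ℓ + η) * n + C ∧ N < α * h * n + β * h + γ * n + δ := by
    intro η hη
    obtain ⟨C, -, -, hA, -⟩ := H η hη
    refine ⟨C, fun N X => ?_⟩
    obtain ⟨n, ⟨h, h₁, h₂, h₃⟩, hX⟩ := ((hA ⌈N⌉).and (large X)).exists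
    exact ⟨n, h, hX, n.cast_nonneg, h₁, h₂, (Int.le_ceil N).trans_lt h₃⟩
  have key₂ : ∀ η : ℝ, 0 < η → ∃ C N C' : ℝ, ∀ X : ℝ, ∃ k h y : ℝ, X ≤ k ∧ X ≤ y ∧ 0 ≤ y ∧
      k ≤ h ∧ h ≤ (ℓ + η) * y + C ∧ y ≤ 2 * (k + 1) / ℓ + C' ∧
      α * h * y + β * h + γ * y + δ < N := by
    intro η hη
    obtain ⟨C, N, C', -, hB⟩ := H η hη
    refine ⟨C, N, C', fun X => ?_⟩
    obtain ⟨k, ⟨⟨h, y, h₀, h₁, h₂, h₃, h₄⟩, hX⟩, hX'⟩ :=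
      ((hB.and (large X)).and (large ((ℓ + η) * X + C))).exists
    refine ⟨k, h, y, hX, ?_, h₀, h₁, h₂, h₃, h₄⟩
    exact le_of_mul_le_mul_left (by linarith) (show 0 < ℓ + η by linarith)
  have hα₀ : 0 ≤ α := by
    by_contra! hα
    obtain ⟨_, hC⟩ := key₁ 1 one_pos
    obtain ⟨n, h, hX, hn, h₁, -, h₃⟩ := hC δ (max 4 ((-2 * |γ| - β) / α))
    have h4 := (le_max_left _ _).trans hX
    have h5 := (le_max_right _ _).trans hX
    rw [div_le_iff_of_neg hα] at h5
    have h6 : n / 2 ≤ h := by nlinarith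
    nlinarith [neg_abs_le γ, le_abs_self γ, abs_nonneg γ,
      mul_nonneg (abs_nonneg γ) (sub_nonneg.2 h6),
      mul_nonneg (show 0 ≤ -2 * |γ| - β - n * α by linarith) (show 0 ≤ h by linarith),
      mul_nonneg (sub_nonneg.2 (le_abs_self γ)) hn]
  have hα₁ : α ≤ 0 := by
    by_contra! hα
    obtain ⟨C, N, C', hC⟩ := key₂ 1 one_pos
    obtain ⟨k, h, y, hk, hX, hy, hkh, -, -, hN⟩ :=
      hC (max (N - δ) (max 0 (2 * (|β| + |γ| + 1) / α)))
    have hXt := (le_max_right _ _).trans ((le_max_right _ _).trans hX)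
    have hXt' := (le_max_right _ _).trans ((le_max_right _ _).trans hk)
    have h0 := (le_max_left _ _).trans ((le_max_right _ _).trans hk)
    have hNk := (le_max_left _ _).trans hk
    rw [div_le_iff₀ hα] at hXt hXt'
    have e₁ : 1 ≤ α * y / 2 + β := by linarith [neg_abs_le β, abs_nonneg γ]
    have e₂ : 0 ≤ α * h / 2 + γ := by nlinarith [neg_abs_le γ, abs_nonneg β]
    have e₃ : h * 1 ≤ h * (α * y / 2 + β) := mul_le_mul_of_nonneg_left e₁ (by linarith)
    have e₄ := mul_nonneg hy e₂
    nlinarith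
  obtain rfl : α = 0 := le_antisymm hα₁ hα₀
  simp only [zero_mul, zero_add] at key₁ key₂
  have hβ : 0 < β := by
    by_contra! hβ
    have hs : 0 < β * ℓ + γ := by
      by_contra! hs
      obtain ⟨_, hC⟩ := key₁ 1 one_pos
      obtain ⟨n, h, -, hn, h₁, -, h₃⟩ := hC (-2 * β + δ) 0
      nlinarith [mul_nonneg (neg_nonneg.2 hβ) (sub_nonneg.2 h₁),
        mul_nonneg (neg_nonneg.2 hs) hn]
    have hη : 0 < (β * ℓ + γ) / (2 * (1 - β)) := by
      apply div_pos hs; linarith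
    obtain ⟨C, N, C', hC⟩ := key₂ _ hη
    set η := (β * ℓ + γ) / (2 * (1 - β)) with hηd
    have hη2 : η * (2 * (1 - β)) = β * ℓ + γ := div_mul_cancel₀ _ (by linarith)
    have hpos : 0 < β * (ℓ + η) + γ := by nlinarith
    obtain ⟨k, h, y, -, hX, hy, hkh, h₂, -, hN⟩ := hC ((N - β * C - δ) / (β * (ℓ + η) + γ))
    rw [div_le_iff₀ hpos] at hX
    nlinarith [mul_nonneg (neg_nonneg.2 hβ) (sub_nonneg.2 h₂)]
  refine ⟨rfl, hβ, ?_, ?_⟩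
  · by_contra! hγ
    obtain ⟨C, N, C', hC⟩ := key₂ 1 one_pos
    rcases le_total 0 γ with h0 | h0
    · obtain ⟨k, h, y, hk, -, hy, hkh, -, -, hN⟩ := hC ((N - δ) / β)
      rw [div_le_iff₀ hβ] at hk
      nlinarith [mul_nonneg h0 hy, mul_le_mul_of_nonneg_left hkh hβ.le]
    · have hℓ0 : 0 < ℓ := by linarith
      have hpos : 0 < β + 2 * γ / ℓ := by
        have : β + 2 * γ / ℓ = (β * ℓ + 2 * γ) / ℓ := by field_simp
        rw [this]
        apply div_pos _ hℓ0
        linarith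
      obtain ⟨k, h, y, hk, -, hy, hkh, -, h₃, hN⟩ :=
        hC ((N - δ - 2 * γ / ℓ - γ * C') / (β + 2 * γ / ℓ))
      rw [div_le_iff₀ hpos] at hk
      have e := mul_le_mul_of_nonpos_left h₃ h0
      have e' : γ * (2 * (k + 1) / ℓ + C') = k * (2 * γ / ℓ) + 2 * γ / ℓ + γ * C' := by ring
      nlinarith [mul_le_mul_of_nonneg_left hkh hβ.le]
  · by_contra! hγ
    have hη : 0 < -(β * ℓ + γ) / β := div_pos (by linarith) hβ
    obtain ⟨C, hC⟩ := key₁ _ hη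
    set η := -(β * ℓ + γ) / β with hηd
    have hη2 : η * β = -(β * ℓ + γ) := div_mul_cancel₀ _ hβ.ne'
    obtain ⟨n, h, -, hn, -, h₂, h₃⟩ := hC (β * C + δ) 0
    have e := mul_le_mul_of_nonneg_left h₂ hβ.le
    have e' : β * ((ℓ + η) * n + C) = (β * ℓ + η * β) * n + β * C := by ring
    rw [e', hη2] at e
    linarith

theorem mainTheorem5 (i : ℕ) (hi : 2 ≤ i) (L : Arith.Script i) (U : Machine 2)
    (hU : U.IsUniversal) (f : ℝ → ℝ → ℝ) (hf : LinearInBoth f) (r : ℕ → ℕ → ℚ)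
    (hr : ∀ x y : ℕ, r x y = (⌊f x y⌋ : ℤ)) (hcomp : ComputableRat r)
    (hacc : Acceptable L U r) :
    ∃ a b ε : ℝ, 0 < a ∧ 1 / 2 ≤ ε ∧ ε ≤ 1 ∧
      ∀ x y : ℕ, r x y = (⌊a * ((x : ℝ) - ε * Real.logb 2 i * y) + b⌋ : ℤ) := by
  obtain ⟨α, β, γ, δ, hfc⟩ := hf.exists_coeffs
  have hℓ : 1 ≤ Real.logb 2 i := by
    rw [Real.le_logb_iff_rpow_le one_lt_two (by positivity)]
    exact_mod_cast hi
  obtain ⟨rfl, hβ, h₁, h₂⟩ := coeffs_of_bounds (ℓ := Real.logb 2 i) (α := α) (β := β) (γ := γ)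
    (δ := δ) hℓ fun η hη => by
      obtain ⟨g, C, hg⟩ := hU.exists_godelNumbering i hη
      obtain ⟨N, C', hB⟩ := hacc.exists_eventually_exists_lt hi g fun u => (hg u).1
      refine ⟨C, N, C', fun N => ?_, ?_⟩
      · filter_upwards [hacc.eventually_exists_lt hi g (fun u => (hg u).1) N] with n hn
        obtain ⟨u, rfl, hu, hN⟩ := hn
        refine ⟨_, hu, (hg u).2, ?_⟩
        rw [← hfc]
        rw [builder, hr, Int.cast_lt] at hN
        exact (Int.cast_lt.2 hN).trans_le (Int.floor_le _)
      · filter_upwards [hB] with k hk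
        obtain ⟨u, hu, hl, hN⟩ := hk
        refine ⟨_, u.length, Nat.cast_nonneg _, hu, (hg u).2, hl, ?_⟩
        rw [← hfc]
        rw [builder, hr, Int.cast_lt] at hN
        exact Int.floor_lt.1 hN
  have hℓ₀ : 0 < Real.logb 2 i := one_pos.trans_le hℓ
  have hpos : 0 < β * Real.logb 2 i := mul_pos hβ hℓ₀
  refine ⟨β, δ, -γ / (β * Real.logb 2 i), hβ, ?_, ?_, fun x y => ?_⟩
  · rw [le_div_iff₀ hpos]; linarith
  · rw [div_le_iff₀ hpos]; linarith
  · rw [hr, hfc]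
    congr 2
    field_simp
    ring
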